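/- Let $p$ be a prime and let $k$ be a field extension of $\mathbb{Q}_p$, complete with respect to a non-archimedean absolute value $|\cdot|$ extending the $p$-adic one $|\cdot|_p$. Let $d\ge 0$, $\mu\ge 1$, $a\in k^d$, and $r,R\in\mathbb{R}_{>0}^d$ with $R_i\le r_i$ for all $i$. Let $\mathcal{O}(D(a,r^-))$ be the ring of analytic functions on the open polydisk $D(a,r^-)=\{|x_i-a_i|<r_i,\ i=1,\dots,d\}$, i.e. of power series $f=\sum_{\alpha\in\mathbb{N}^d}c_\alpha(x-a)^\alpha$ over $k$ with $|c_\alpha|\rho^\alpha\to 0$ for every $\rho$ with $0<\rho_i<r_i$, and let $\mathcal{M}(D(a,r^-))$, the field of meromorphic functions, be its field of fractions. For such $\rho$ put $|f(t_{a,\rho})|=\sup_\alpha|c_\alpha|\rho^\alpha$ for $f$ analytic, extended multiplicatively to meromorphic functions. The boundary seminorm of $f\in\mathcal{M}(D(a,R^-))$ is $$\|f\|_{a,R}=\limsup_{\rho\to R,\ 0<\rho_i<R_i}|f(t_{a,\rho})|\in[0,\infty],$$ and the boundary seminorm of a matrix is the maximum of those of its entries. Let $$\frac{\partial \vec y}{\partial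 x_i}=G_i\,\vec y,\qquad i=1,\dots,d,$$ be an integrable system whose coefficients $G_i$ are $\mu\times\mu$ matrices with entries in $\mathcal{M}(D(a,r^-))$. Define $G_\alpha$, $\alpha\in\mathbb{N}^d$, by $G_0=I_\mu$ and $G_{\alpha+1_i}=\frac{\partial}{\partial x_i}G_\alpha+G_\alpha G_i$, where $1_i$ is the $i$-th standard basis vector of $\mathbb{N}^d$ (so that $\partial^\alpha\vec y=G_\alpha\vec y$ for solutions), and put $G_{[\alpha]}=G_\alpha/\alpha!$, where $\alpha!=\prod_i\alpha_i!$. For $\alpha\in\mathbb{N}^d$ write $|\alpha|=\sum_i\alpha_i$ and $R^\alpha=\prod_iR_i^{\alpha_i}$. For $s,n\in\mathbb{N}$ let $$\{s,n\}_p=\max\frac{1}{|\lambda_1\cdots\lambda_m|_p},\qquad m=\min(n,s),$$ the maximum being over all integers $1\le\lambda_1<\dots<\lambda_m\le s$ (so $\{s,n\}_p=1/|s!|_p$ if $s\le n$). Suppose that the system admits a solution matrix $Y\in GL(\mu,\mathcal{M}(D(a,R^-)))$. Then for every $\alpha\in\mathbb{N}^d$ $$\|G_{[\alpha]}\|_{a,R}\le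 C\,\{|\alpha|,\mu-1\}_p\,R^{-\alpha},\qquad C=\max_{|\beta|<\mu}R^\beta\,\|\beta!\,G_{[\beta]}\|_{a,R}.$$ -/

import Mathlib

open Filter Topology
open scoped ENNReal NNReal

/-! ### Extending a derivation to the field of fractions -/

section FractionField

variable {k A : Type*} [Field k] [CommRing A] [IsDomain A] [Algebra k A]

/-- The quotient rule for a derivation `D`, on a chosen representation of `x` as a fraction. -/
noncomputable def fracDerivFun (D : Derivation k A A) (x : FractionRing A) : FractionRing A :=
  let s := IsLocalization.sec (nonZeroDivisors A) x
  (algebraMap A (FractionRing A) (D s.1 * s.2 - s.1 * D s.2)) /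
    (algebraMap A (FractionRing A) s.2) ^ 2

theorem fracDerivFun_div (D : Derivation k A A) (f g : A) (hg : g ≠ 0) :
    fracDerivFun D (algebraMap A (FractionRing A) f / algebraMap A (FractionRing A) g) =
      algebraMap A (FractionRing A) (D f * g - f * D g) / (algebraMap A (FractionRing A) g) ^ 2 := by
  set x := algebraMap A (FractionRing A) f / algebraMap A (FractionRing A) g with hx
  have hinj := IsFractionRing.injective A (FractionRing A)
  unfold fracDerivFun
  set s := IsLocalization.sec (nonZeroDivisors A) x with hs
  have hs2 : (s.2 : A) ≠ 0 := nonZeroDivisors.ne_zero s.2.2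
  have hg' : algebraMap A (FractionRing A) g ≠ 0 := by
    simpa using (map_ne_zero_iff _ hinj).2 hg
  have hs' : algebraMap A (FractionRing A) s.2 ≠ 0 := (map_ne_zero_iff _ hinj).2 hs2
  have h1 : x * algebraMap A (FractionRing A) s.2 = algebraMap A (FractionRing A) s.1 :=
    IsLocalization.sec_spec (nonZeroDivisors A) x
  have h2 : f * s.2 = s.1 * g := by
    apply hinj
    rw [map_mul, map_mul, ← h1, hx]
    field_simp
  have h3 : f * D s.2 + s.2 * D f = s.1 * D g + g * D s.1 := by
    have := congrArg D h2
    simpa [Derivation.leibniz] using this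
  rw [div_eq_div_iff (pow_ne_zero 2 hs') (pow_ne_zero 2 hg'), ← map_pow, ← map_pow, ← map_mul,
    ← map_mul]
  congr 1
  linear_combination (-(g * (s.2 : A))) * h3 + (g * D (s.2 : A) + s.2 * D g) * h2

/-- The unique extension of a derivation of a domain to its field of fractions. -/
noncomputable def fracDeriv (D : Derivation k A A) :
    Derivation k (FractionRing A) (FractionRing A) :=
  Derivation.mk'
    { toFun := fracDerivFun D
      map_add' := by
        intro x y
        obtain ⟨f, g, hg, rfl⟩ := IsFractionRing.div_surjective A x
        obtain ⟨f', g', hg', rfl⟩ := IsFractionRing.div_surjective A y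
        have hg0 := nonZeroDivisors.ne_zero hg
        have hg0' := nonZeroDivisors.ne_zero hg'
        have h1 : algebraMap A (FractionRing A) g ≠ 0 :=
          (map_ne_zero_iff _ (IsFractionRing.injective A (FractionRing A))).2 hg0
        have h2 : algebraMap A (FractionRing A) g' ≠ 0 :=
          (map_ne_zero_iff _ (IsFractionRing.injective A (FractionRing A))).2 hg0'
        rw [fracDerivFun_div D f g hg0, fracDerivFun_div D f' g' hg0', div_add_div _ _ h1 h2,
          ← map_mul, ← map_mul, ← map_add, ← map_mul, fracDerivFun_div D _ _ (mul_ne_zero hg0 hg0')]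
        simp only [map_mul, map_sub, map_add, Derivation.leibniz, smul_eq_mul]
        field_simp
        ring
      map_smul' := by
        intro c x
        obtain ⟨f, g, hg, rfl⟩ := IsFractionRing.div_surjective A x
        have hg0 := nonZeroDivisors.ne_zero hg
        have : c • (algebraMap A (FractionRing A) f / algebraMap A (FractionRing A) g) =
            algebraMap A (FractionRing A) (c • f) / algebraMap A (FractionRing A) g := by
          rw [Algebra.smul_def, Algebra.smul_def, map_mul,
            ← IsScalarTower.algebraMap_apply k A (FractionRing A), mul_div_assoc]
        rw [this, fracDerivFun_div D _ _ hg0, fracDerivFun_div D _ _ hg0]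
        simp only [RingHom.id_apply, Derivation.map_smul]
        rw [smul_mul_assoc, smul_mul_assoc, ← smul_sub, Algebra.smul_def, Algebra.smul_def,
          map_mul, ← IsScalarTower.algebraMap_apply k A (FractionRing A), mul_div_assoc] }
    (by
      intro x y
      obtain ⟨f, g, hg, rfl⟩ := IsFractionRing.div_surjective A x
      obtain ⟨f', g', hg', rfl⟩ := IsFractionRing.div_surjective A y
      have hg0 := nonZeroDivisors.ne_zero hg
      have hg0' := nonZeroDivisors.ne_zero hg'
      have h1 : algebraMap A (FractionRing A) g ≠ 0 :=
        (map_ne_zero_iff _ (IsFractionRing.injective A (FractionRing A))).2 hg0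
      have h2 : algebraMap A (FractionRing A) g' ≠ 0 :=
        (map_ne_zero_iff _ (IsFractionRing.injective A (FractionRing A))).2 hg0'
      show fracDerivFun D _ = _ • fracDerivFun D _ + _ • fracDerivFun D _
      rw [fracDerivFun_div D f g hg0, fracDerivFun_div D f' g' hg0', div_mul_div_comm,
        ← map_mul, ← map_mul, fracDerivFun_div D _ _ (mul_ne_zero hg0 hg0')]
      simp only [map_mul, map_sub, map_add, Derivation.leibniz, smul_eq_mul]
      field_simp
      ring)

theorem fracDeriv_algebraMap (D : Derivation k A A) (f : A) :
    fracDeriv D (algebraMap A (FractionRing A) f) = algebraMap A (FractionRing A) (D f) := by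
  have := fracDerivFun_div D f 1 one_ne_zero
  simp only [map_one, div_one, mul_one, Derivation.map_one_eq_zero, mul_zero, sub_zero,
    one_pow] at this
  exact this

end FractionField

namespace DworkRobba

variable {k : Type*} [NormedField k] [IsUltrametricDist k] {d : ℕ}

/-! ### Analytic and meromorphic functions on an open polydisk -/

/-- The algebra `𝒪(D(a, r⁻))` of analytic functions on the open polydisk
`D(a, r⁻) = {|x_i - a_i| < r_i}`. The power series `∑ c_α X^α` stands for the function
`∑ c_α (x - a)^α` (see `evalAt`); the condition is that it converges on every closed polydisk
`D(a, ρ⁺)` with `0 < ρ_i < r_i`. -/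
def Hol (_a : Fin d → k) (r : Fin d → ℝ) : Subalgebra k (MvPowerSeries (Fin d) k) where
  carrier := {f | ∀ ρ : Fin d → ℝ, (∀ i, 0 < ρ i ∧ ρ i < r i) → MvPowerSeries.IsRestricted ρ f}
  mul_mem' hf hg ρ hρ := MvPowerSeries.isRestricted.mul ρ (hf ρ hρ) (hg ρ hρ)
  add_mem' hf hg ρ hρ := MvPowerSeries.isRestricted.add ρ (hf ρ hρ) (hg ρ hρ)
  algebraMap_mem' c ρ _ := MvPowerSeries.isRestricted_C ρ c

instance (a : Fin d → k) (r : Fin d → ℝ) : IsDomain (Hol a r) :=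
  haveI : IsDomain (MvPowerSeries (Fin d) k) := NoZeroDivisors.to_isDomain _
  inferInstance

/-- The value at `x` of an analytic function on `D(a, r⁻)`. -/
noncomputable def evalAt (a : Fin d → k) (r : Fin d → ℝ) (f : Hol a r) (x : Fin d → k) : k :=
  ∑' α : Fin d →₀ ℕ, MvPowerSeries.coeff α f.1 * α.prod fun i n => (x i - a i) ^ n

theorem summable_evalAt [CompleteSpace k] (a : Fin d → k) (r : Fin d → ℝ) (f : Hol a r)
    (x : Fin d → k) (hx : ∀ i, ‖x i - a i‖ < r i) :
    Summable fun α : Fin d →₀ ℕ =>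
      MvPowerSeries.coeff α f.1 * α.prod fun i n => (x i - a i) ^ n := by
  apply NonarchimedeanAddGroup.summable_of_tendsto_cofinite_zero
  have hρ : ∀ i, ∃ ρ : ℝ, ‖x i - a i‖ < ρ ∧ ρ < r i := fun i => exists_between (hx i)
  choose ρ h1 h2 using hρ
  have h0 : ∀ i, 0 < ρ i := fun i => (norm_nonneg _).trans_lt (h1 i)
  refine squeeze_zero_norm (fun α => ?_) (f.2 ρ fun i => ⟨h0 i, h2 i⟩)
  rw [norm_mul]
  refine mul_le_mul_of_nonneg_left ?_ (norm_nonneg _)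
  rw [Finsupp.prod, Finsupp.prod, norm_prod]
  refine Finset.prod_le_prod (fun _ _ => norm_nonneg _) fun i _ => ?_
  rw [norm_pow]
  exact pow_le_pow_left₀ (norm_nonneg _) (h1 i).le _

/-- The field `ℳ(D(a, r⁻))` of meromorphic functions: the field of fractions of
`𝒪(D(a, r⁻))`. -/
abbrev Mero (a : Fin d → k) (r : Fin d → ℝ) : Type _ := FractionRing (Hol a r)

theorem Hol.mono (a : Fin d → k) {r R : Fin d → ℝ} (h : ∀ i, R i ≤ r i) : Hol a r ≤ Hol a R :=
  fun _ hf ρ hρ => hf ρ fun i => ⟨(hρ i).1, (hρ i).2.trans_le (h i)⟩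

/-- Restriction of meromorphic functions from `D(a, r⁻)` to a smaller polydisk `D(a, R⁻)`. -/
noncomputable def Mero.restrict (a : Fin d → k) {r R : Fin d → ℝ} (h : ∀ i, R i ≤ r i) :
    Mero a r →+* Mero a R :=
  IsFractionRing.map (A := Hol a r) (B := Hol a R) (K := Mero a r) (L := Mero a R)
    (j := (Subalgebra.inclusion (Hol.mono a h)).toRingHom)
    (Subalgebra.inclusion_injective (Hol.mono a h))

theorem pderiv_mem_Hol (a : Fin d → k) (r : Fin d → ℝ) (i : Fin d)
    {f : MvPowerSeries (Fin d) k} (hf : f ∈ Hol a r) : MvPowerSeries.pderiv k i f ∈ Hol a r := by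
  intro ρ hρ
  have h0 : ∀ j, 0 < ρ j := fun j => (hρ j).1
  have hinj : Function.Injective fun α : Fin d →₀ ℕ => α + Finsupp.single i 1 :=
    fun _ _ h => add_right_cancel h
  have h := ((hf ρ hρ).comp hinj.tendsto_cofinite).mul_const (ρ i)⁻¹
  rw [zero_mul] at h
  refine squeeze_zero (fun α => ?_) (fun α => ?_) h
  · exact mul_nonneg (norm_nonneg _) (Finset.prod_nonneg fun j _ => pow_nonneg (h0 j).le _)
  · have hn : ‖((α i : k) + 1)‖ ≤ 1 := by
      exact_mod_cast IsUltrametricDist.norm_natCast_le_one k (α i + 1)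
    have hp : (α + Finsupp.single i 1).prod (fun j n => ρ j ^ n) =
        α.prod (fun j n => ρ j ^ n) * ρ i := by
      rw [Finsupp.prod_add_index' (by simp) (by intros; exact pow_add _ _ _)]
      simp
    simp only [Function.comp_apply]
    rw [MvPowerSeries.coeff_pderiv, norm_mul, hp]
    have hP : 0 ≤ α.prod (fun j n => ρ j ^ n) :=
      Finset.prod_nonneg fun j _ => pow_nonneg (h0 j).le _
    have e : ‖MvPowerSeries.coeff (α + Finsupp.single i 1) f‖ *
        (α.prod (fun j n => ρ j ^ n) * ρ i) * (ρ i)⁻¹ =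
        ‖MvPowerSeries.coeff (α + Finsupp.single i 1) f‖ * α.prod (fun j n => ρ j ^ n) := by
      have := (h0 i).ne'
      field_simp
    rw [e]
    exact mul_le_mul_of_nonneg_right (mul_le_of_le_one_right (norm_nonneg _) hn) hP

/-- `∂/∂x_i` on `𝒪(D(a, r⁻))`. -/
noncomputable def Hol.pderiv (a : Fin d → k) (r : Fin d → ℝ) (i : Fin d) :
    Derivation k (Hol a r) (Hol a r) :=
  Derivation.mk'
    { toFun := fun f => ⟨MvPowerSeries.pderiv k i f.1, pderiv_mem_Hol a r i f.2⟩
      map_add' := fun _ _ => Subtype.ext (map_add _ _ _)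
      map_smul' := fun c f => Subtype.ext ((MvPowerSeries.pderiv k i).map_smul c f.1) }
    fun f g => Subtype.ext ((MvPowerSeries.pderiv k i).leibniz f.1 g.1)

/-- `∂/∂x_i` on `ℳ(D(a, r⁻))`. -/
noncomputable def Mero.pderiv (a : Fin d → k) (r : Fin d → ℝ) (i : Fin d) :
    Derivation k (Mero a r) (Mero a r) :=
  fracDeriv (Hol.pderiv a r i)

theorem Mero.pderiv_comm (a : Fin d → k) (r : Fin d → ℝ) (i j : Fin d) (x : Mero a r) :
    Mero.pderiv a r i (Mero.pderiv a r j x) = Mero.pderiv a r j (Mero.pderiv a r i x) := by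
  have hol : ∀ f : Hol a r, ⁅Mero.pderiv a r i, Mero.pderiv a r j⁆
      (algebraMap (Hol a r) (Mero a r) f) = 0 := by
    intro f
    rw [Derivation.commutator_apply, sub_eq_zero]
    simp only [Mero.pderiv, fracDeriv_algebraMap]
    congr 1
    apply Subtype.ext
    show MvPowerSeries.pderiv k i (MvPowerSeries.pderiv k j f.1) =
      MvPowerSeries.pderiv k j (MvPowerSeries.pderiv k i f.1)
    ext n
    simp only [MvPowerSeries.coeff_pderiv]
    rcases eq_or_ne i j with rfl | hij
    · rfl
    · simp [add_right_comm, hij, hij.symm, mul_right_comm]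
  rw [← sub_eq_zero, ← Derivation.commutator_apply]
  obtain ⟨f, g, hg, rfl⟩ := IsFractionRing.div_surjective (Hol a r) x
  have hg0 : algebraMap (Hol a r) (Mero a r) g ≠ 0 :=
    (map_ne_zero_iff _ (IsFractionRing.injective (Hol a r) (Mero a r))).2
      (nonZeroDivisors.ne_zero hg)
  rw [Derivation.leibniz_div, hol, hol]
  simp

/-! ### The maximal points and the boundary seminorm -/

/-- `|f(t_{a,ρ})|` for `f` analytic: `t_{a,ρ}` is the maximal point of `D(a, ρ⁺)`, so this is the
Gauss norm `sup_α |c_α| ρ^α`. -/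
noncomputable def holNorm {a : Fin d → k} {r : Fin d → ℝ} (ρ : Fin d → ℝ) (f : Hol a r) : ℝ :=
  MvPowerSeries.gaussNorm (fun c : k => ‖c‖) ρ f.1

/-- `|f(t_{a,ρ})|` for `f` meromorphic, the multiplicative extension of `holNorm`, computed on a
chosen fraction; it does not depend on the fraction, see `meroNorm_div`. -/
noncomputable def meroNorm {a : Fin d → k} {r : Fin d → ℝ} (ρ : Fin d → ℝ) (x : Mero a r) : ℝ :=
  let s := IsLocalization.sec (nonZeroDivisors (Hol a r)) x
  holNorm ρ s.1 / holNorm ρ (s.2 : Hol a r)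

section GaussNorm

variable {a : Fin d → k} {r ρ : Fin d → ℝ}

theorem hasGaussNorm_of_isRestricted {f : MvPowerSeries (Fin d) k}
    (hf : MvPowerSeries.IsRestricted ρ f) :
    MvPowerSeries.HasGaussNorm (fun c : k => ‖c‖) ρ f := by
  have h1 : ∀ᶠ t : Fin d →₀ ℕ in cofinite,
      ‖MvPowerSeries.coeff t f‖ * t.prod (ρ · ^ ·) < 1 :=
    (hf.eventually (gt_mem_nhds one_pos))
  rw [eventually_cofinite] at h1
  obtain ⟨M, hM⟩ := (h1.image fun t => ‖MvPowerSeries.coeff t f‖ * t.prod (ρ · ^ ·)).bddAbove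
  refine ⟨max M 1, ?_⟩
  rintro _ ⟨t, rfl⟩
  by_cases ht : ‖MvPowerSeries.coeff t f‖ * t.prod (ρ · ^ ·) < 1
  · exact ht.le.trans (le_max_right _ _)
  · exact (hM ⟨t, ht, rfl⟩).trans (le_max_left _ _)

theorem gaussNorm_pos (hρ : ∀ i, 0 < ρ i) {f : MvPowerSeries (Fin d) k}
    (hf : MvPowerSeries.IsRestricted ρ f) (h0 : f ≠ 0) :
    0 < MvPowerSeries.gaussNorm (fun c : k => ‖c‖) ρ f := by
  refine lt_of_le_of_ne (MvPowerSeries.gaussNorm_nonneg _ _ _ fun c => norm_nonneg c) fun h => h0 ?_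
  exact (MvPowerSeries.gaussNorm_eq_zero_iff _ _ _ norm_zero (fun c => norm_nonneg c)
    (fun c hc => norm_eq_zero.1 hc) hρ (hasGaussNorm_of_isRestricted hf)).1 h.symm

/-- Among the indices at which the Gauss norm is attained there is a largest one for the
lexicographic order. -/
theorem exists_lexMax (hρ : ∀ i, 0 < ρ i) {f : MvPowerSeries (Fin d) k}
    (hf : MvPowerSeries.IsRestricted ρ f) (h0 : f ≠ 0) :
    ∃ i, MvPowerSeries.AchievesGaussNorm (fun c : k => ‖c‖) ρ f i ∧
      ∀ j, MvPowerSeries.AchievesGaussNorm (fun c : k => ‖c‖) ρ f j → toLex j ≤ toLex i := by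
  set N := MvPowerSeries.gaussNorm (fun c : k => ‖c‖) ρ f with hN
  have hpos : 0 < N := gaussNorm_pos hρ hf h0
  have hfin : {t : Fin d →₀ ℕ | ¬ ‖MvPowerSeries.coeff t f‖ * t.prod (ρ · ^ ·) < N / 2}.Finite :=
    eventually_cofinite.1 (hf.eventually (gt_mem_nhds (half_pos hpos)))
  have hsub : {t | MvPowerSeries.AchievesGaussNorm (fun c : k => ‖c‖) ρ f t} ⊆
      {t : Fin d →₀ ℕ | ¬ ‖MvPowerSeries.coeff t f‖ * t.prod (ρ · ^ ·) < N / 2} := by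
    intro t ht
    have ht' : ‖MvPowerSeries.coeff t f‖ * t.prod (ρ · ^ ·) = N := ht
    simp only [Set.mem_ofPred_eq, ht', not_lt]
    linarith
  have hne : {t | MvPowerSeries.AchievesGaussNorm (fun c : k => ‖c‖) ρ f t}.Nonempty := by
    by_contra hemp
    have hbig : {t : Fin d →₀ ℕ |
        ¬ ‖MvPowerSeries.coeff t f‖ * t.prod (ρ · ^ ·) < N / 2}.Nonempty := by
      by_contra hno
      rw [Set.not_nonempty_iff_eq_empty] at hno
      have : N ≤ N / 2 := by
        refine ciSup_le fun t => ?_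
        have ht : t ∉ {t : Fin d →₀ ℕ |
          ¬ ‖MvPowerSeries.coeff t f‖ * t.prod (ρ · ^ ·) < N / 2} := by rw [hno]; simp
        simp only [Set.mem_ofPred_eq, not_not] at ht
        exact ht.le
      linarith
    obtain ⟨m, hm, hmax⟩ := Set.exists_max_image _
      (fun t : Fin d →₀ ℕ => ‖MvPowerSeries.coeff t f‖ * t.prod (ρ · ^ ·)) hfin hbig
    refine hemp ⟨m, le_antisymm ?_ ?_⟩
    · exact MvPowerSeries.le_gaussNorm _ _ _ (hasGaussNorm_of_isRestricted hf) m
    · refine ciSup_le fun t => ?_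
      by_cases ht : ‖MvPowerSeries.coeff t f‖ * t.prod (ρ · ^ ·) < N / 2
      · exact ht.le.trans (not_lt.1 hm)
      · exact hmax t ht
  obtain ⟨i, hi, hmax⟩ := Set.exists_max_image _ (fun t : Fin d →₀ ℕ => toLex t)
    (hfin.subset hsub) hne
  exact ⟨i, hi, hmax⟩

theorem gaussNorm_mul (hρ : ∀ i, 0 < ρ i) {f g : MvPowerSeries (Fin d) k}
    (hf : MvPowerSeries.IsRestricted ρ f) (hg : MvPowerSeries.IsRestricted ρ g) :
    MvPowerSeries.gaussNorm (fun c : k => ‖c‖) ρ (f * g) =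
      MvPowerSeries.gaussNorm (fun c : k => ‖c‖) ρ f *
        MvPowerSeries.gaussNorm (fun c : k => ‖c‖) ρ g := by
  rcases eq_or_ne f 0 with rfl | hf0
  · simp [MvPowerSeries.gaussNorm_zero]
  rcases eq_or_ne g 0 with rfl | hg0
  · simp [MvPowerSeries.gaussNorm_zero]
  obtain ⟨i, hi, hi'⟩ := exists_lexMax hρ hf hf0
  obtain ⟨j, hj, hj'⟩ := exists_lexMax hρ hg hg0
  have bf := hasGaussNorm_of_isRestricted hf
  have bg := hasGaussNorm_of_isRestricted hg
  refine MvPowerSeries.gaussNorm_mul_eq_mul _ ρ f g bf bg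
    (hasGaussNorm_of_isRestricted (MvPowerSeries.isRestricted.mul ρ hf hg))
    (fun c => norm_nonneg c) norm_zero
    (fun x y => IsUltrametricDist.norm_add_le_max x y) norm_mul norm_neg
    (fun c hc => norm_eq_zero.1 hc) hρ ⟨i, j, hi, hj, ?_⟩
  intro q hq hne
  have hq : q.1 + q.2 = i + j := Finset.HasAntidiagonal.mem_antidiagonal.1 hq
  have hw : ∀ t : Fin d →₀ ℕ, 0 < t.prod (ρ · ^ ·) := fun t =>
    Finset.prod_pos fun l _ => pow_pos (hρ l) _
  have hmulw : ∀ s t : Fin d →₀ ℕ, (s + t).prod (ρ · ^ ·) =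
      s.prod (ρ · ^ ·) * t.prod (ρ · ^ ·) := fun s t =>
    Finsupp.prod_add_index' (by simp) (by intros; exact pow_add _ _ _)
  have l1 := MvPowerSeries.le_gaussNorm _ _ _ bf q.1
  have l2 := MvPowerSeries.le_gaussNorm _ _ _ bg q.2
  have pf := gaussNorm_pos hρ hf hf0
  have pg := gaussNorm_pos hρ hg hg0
  set Nf := MvPowerSeries.gaussNorm (fun c : k => ‖c‖) ρ f
  set Ng := MvPowerSeries.gaussNorm (fun c : k => ‖c‖) ρ g
  have key : (‖MvPowerSeries.coeff q.1 f‖ * q.1.prod (ρ · ^ ·)) *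
      (‖MvPowerSeries.coeff q.2 g‖ * q.2.prod (ρ · ^ ·)) < Nf * Ng := by
    have nn2 : 0 ≤ ‖MvPowerSeries.coeff q.2 g‖ * q.2.prod (ρ · ^ ·) :=
      mul_nonneg (norm_nonneg _) (hw _).le
    rcases l1.lt_or_eq with h1 | h1
    · calc _ ≤ (‖MvPowerSeries.coeff q.1 f‖ * q.1.prod (ρ · ^ ·)) * Ng :=
            mul_le_mul_of_nonneg_left l2 (mul_nonneg (norm_nonneg _) (hw _).le)
        _ < Nf * Ng := mul_lt_mul_of_pos_right h1 pg
    rcases l2.lt_or_eq with h2 | h2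
    · calc _ ≤ Nf * (‖MvPowerSeries.coeff q.2 g‖ * q.2.prod (ρ · ^ ·)) :=
            mul_le_mul_of_nonneg_right l1 nn2
        _ < Nf * Ng := mul_lt_mul_of_pos_left h2 pf
    exfalso
    have a1 := hi' _ h1
    have a2 := hj' _ h2
    have hsum : toLex q.1 + toLex q.2 = toLex i + toLex j := congrArg toLex hq
    have e1 : toLex q.1 = toLex i := by
      refine le_antisymm a1 (not_lt.1 fun hlt => ?_)
      exact absurd hsum (add_lt_add_of_lt_of_le hlt a2).ne
    have e2 : toLex q.2 = toLex j := by
      rw [e1] at hsum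
      exact add_left_cancel hsum
    exact hne (Prod.ext (toLex.injective e1) (toLex.injective e2))
  have hi2 : ‖MvPowerSeries.coeff i f‖ * i.prod (ρ · ^ ·) = Nf := hi
  have hj2 : ‖MvPowerSeries.coeff j g‖ * j.prod (ρ · ^ ·) = Ng := hj
  rw [← hi2, ← hj2, mul_mul_mul_comm ‖MvPowerSeries.coeff q.1 f‖,
    mul_mul_mul_comm ‖MvPowerSeries.coeff i f‖, ← hmulw, ← hmulw, hq, ← norm_mul] at key
  exact lt_of_mul_lt_mul_right key (hw _).le

theorem meroNorm_div (hρ : ∀ i, 0 < ρ i ∧ ρ i < r i) (f g : Hol a r) (hg : g ≠ 0) :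
    meroNorm ρ (algebraMap (Hol a r) (Mero a r) f / algebraMap (Hol a r) (Mero a r) g) =
      holNorm ρ f / holNorm ρ g := by
  have h0 : ∀ i, 0 < ρ i := fun i => (hρ i).1
  set x := algebraMap (Hol a r) (Mero a r) f / algebraMap (Hol a r) (Mero a r) g with hx
  have hinj := IsFractionRing.injective (Hol a r) (Mero a r)
  unfold meroNorm
  set s := IsLocalization.sec (nonZeroDivisors (Hol a r)) x with hs
  have hs2 : (s.2 : Hol a r) ≠ 0 := nonZeroDivisors.ne_zero s.2.2
  have hg' : algebraMap (Hol a r) (Mero a r) g ≠ 0 := (map_ne_zero_iff _ hinj).2 hg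
  have h1 : x * algebraMap (Hol a r) (Mero a r) s.2 = algebraMap (Hol a r) (Mero a r) s.1 :=
    IsLocalization.sec_spec (nonZeroDivisors (Hol a r)) x
  have h2 : s.1 * g = f * s.2 := by
    apply hinj
    rw [map_mul, map_mul, ← h1, hx]
    field_simp
  have pg : 0 < holNorm ρ g :=
    gaussNorm_pos h0 (g.2 ρ hρ) fun h => hg (Subtype.ext h)
  have ps : 0 < holNorm ρ (s.2 : Hol a r) :=
    gaussNorm_pos h0 ((s.2 : Hol a r).2 ρ hρ) fun h => hs2 (Subtype.ext h)
  have hm : ∀ u v : Hol a r, holNorm ρ (u * v) = holNorm ρ u * holNorm ρ v := fun u v =>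
    gaussNorm_mul h0 (u.2 ρ hρ) (v.2 ρ hρ)
  show holNorm ρ s.1 / holNorm ρ (s.2 : Hol a r) = _
  rw [div_eq_div_iff ps.ne' pg.ne', ← hm, ← hm, h2]

end GaussNorm

/-- The boundary seminorm `‖f‖_{a,R} = limsup_{ρ → R} |f(t_{a,ρ})| ∈ [0, ∞]`, where
`0 < ρ_i < R_i`. -/
noncomputable def boundarySeminorm {a : Fin d → k} {R : Fin d → ℝ} (x : Mero a R) : ℝ≥0∞ :=
  limsup (fun ρ : Fin d → ℝ => ENNReal.ofReal (meroNorm ρ x))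
    (𝓝[{ρ | ∀ i, 0 < ρ i ∧ ρ i < R i}] R)

/-- The boundary seminorm of a matrix: the supremum over its entries. -/
noncomputable def boundarySeminormMat {μ : ℕ} {a : Fin d → k} {R : Fin d → ℝ}
    (M : Matrix (Fin μ) (Fin μ) (Mero a R)) : ℝ≥0∞ :=
  ⨆ (i : Fin μ) (j : Fin μ), boundarySeminorm (M i j)

/-! ### Integrable systems and their iterates -/

section System

variable {μ : ℕ} {a : Fin d → k} {r : Fin d → ℝ}

/-- `∂/∂x_i` applied to each entry of a matrix. -/
noncomputable def matPderiv (i : Fin d) (M : Matrix (Fin μ) (Fin μ) (Mero a r)) :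
    Matrix (Fin μ) (Fin μ) (Mero a r) :=
  M.map (Mero.pderiv a r i)

/-- The system `∂y/∂x_i = G_i y`, `i = 1, …, d`, is integrable. -/
def IsIntegrable (G : Fin d → Matrix (Fin μ) (Fin μ) (Mero a r)) : Prop :=
  ∀ i j, matPderiv i (G j) + G j * G i = matPderiv j (G i) + G i * G j

/-- If `∂^α y = H y` then `∂_i ∂^α y = (∂_i H + H G_i) y`. -/
noncomputable def iterStep (G : Fin d → Matrix (Fin μ) (Fin μ) (Mero a r)) (i : Fin d)
    (H : Matrix (Fin μ) (Fin μ) (Mero a r)) : Matrix (Fin μ) (Fin μ) (Mero a r) :=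
  matPderiv i H + H * G i

/-- The matrix `G_α` with `∂^α y = G_α y` for solutions `y`, obtained from `G_0 = 1` by iterating
the system `α_i` times in each variable `x_i`. For an integrable system the order of the variables
is irrelevant and `G_{α + 1_i} = ∂_i G_α + G_α G_i` for all `α` and `i`, see `iterG_succ`. -/
noncomputable def iterG (G : Fin d → Matrix (Fin μ) (Fin μ) (Mero a r)) (α : Fin d → ℕ) :
    Matrix (Fin μ) (Fin μ) (Mero a r) :=
  (List.finRange d).foldr (fun i H => (iterStep G i)^[α i] H) 1

/-- `G_{[α]} = G_α / α!`. -/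
noncomputable def iterGDiv (G : Fin d → Matrix (Fin μ) (Fin μ) (Mero a r)) (α : Fin d → ℕ) :
    Matrix (Fin μ) (Fin μ) (Mero a r) :=
  ((∏ i, (α i).factorial : ℕ) : Mero a r)⁻¹ • iterG G α

theorem matPderiv_add (i : Fin d) (M N : Matrix (Fin μ) (Fin μ) (Mero a r)) :
    matPderiv i (M + N) = matPderiv i M + matPderiv i N := by
  ext u v
  simp [matPderiv]

theorem matPderiv_mul (i : Fin d) (M N : Matrix (Fin μ) (Fin μ) (Mero a r)) :
    matPderiv i (M * N) = matPderiv i M * N + M * matPderiv i N := by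
  ext u v
  simp only [matPderiv, Matrix.map_apply, Matrix.mul_apply, Matrix.add_apply, map_sum,
    Derivation.leibniz, smul_eq_mul, ← Finset.sum_add_distrib]
  refine Finset.sum_congr rfl fun w _ => ?_
  ring

theorem matPderiv_comm (i j : Fin d) (M : Matrix (Fin μ) (Fin μ) (Mero a r)) :
    matPderiv i (matPderiv j M) = matPderiv j (matPderiv i M) := by
  ext u v
  exact Mero.pderiv_comm a r i j _

theorem iterStep_commute {G : Fin d → Matrix (Fin μ) (Fin μ) (Mero a r)} (hG : IsIntegrable G)
    (i j : Fin d) : Function.Commute (iterStep G i) (iterStep G j) := by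
  intro H
  have h := congrArg (fun M => H * M) (hG i j)
  simp only [mul_add] at h
  simp only [iterStep, matPderiv_add, matPderiv_mul, add_mul, matPderiv_comm i j H, mul_assoc]
  calc _ = matPderiv j (matPderiv i H) + matPderiv i H * G j + matPderiv j H * G i +
        (H * matPderiv i (G j) + H * (G j * G i)) := by abel
    _ = _ := by rw [h]; abel

theorem iterG_succ {G : Fin d → Matrix (Fin μ) (Fin μ) (Mero a r)} (hG : IsIntegrable G)
    (α : Fin d → ℕ) (i : Fin d) :
    iterG G (α + Pi.single i 1) = matPderiv i (iterG G α) + iterG G α * G i := by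
  have aux : ∀ l : List (Fin d), l.Nodup →
      l.foldr (fun j H => (iterStep G j)^[(α + Pi.single i 1 : Fin d → ℕ) j] H) 1 =
        if i ∈ l then iterStep G i (l.foldr (fun j H => (iterStep G j)^[α j] H) 1)
        else l.foldr (fun j H => (iterStep G j)^[α j] H) 1 := by
    intro l
    induction l with
    | nil => simp
    | cons j l ih =>
      intro hl
      rw [List.nodup_cons] at hl
      simp only [List.foldr_cons, ih hl.2, List.mem_cons]
      rcases eq_or_ne i j with rfl | hij
      · simp [hl.1, Function.iterate_succ_apply']
      · by_cases hi : i ∈ l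
        · simp only [hi, or_true, if_true, Pi.add_apply, Pi.single_eq_of_ne hij.symm, add_zero]
          exact ((iterStep_commute hG i j).iterate_right (α j) _).symm
        · simp [hi, hij]
  have := aux (List.finRange d) (List.nodup_finRange d)
  simpa [iterG, iterStep] using this

end System

/-- `{s, n}_p`, the largest value of `1 / |λ_1 ⋯ λ_n|_p` over integers
`1 ≤ λ_1 < ⋯ < λ_n ≤ s`. When `s < n` there is no such `n`-tuple, and all of
`1, …, s` are taken instead. -/
noncomputable def chainConst (p : ℕ) [Fact p.Prime] (s n : ℕ) : ℝ≥0 :=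
  ((Finset.Icc 1 s).powersetCard (min n s)).sup fun T =>
    ‖((∏ j ∈ T, j : ℕ) : ℚ_[p])‖₊⁻¹

end DworkRobba

open DworkRobba

/-!
For a solution matrix `Y` one has `∂^α Y = G_α Y`, so the `u`-th row of `G_α` is the image of the
row `∂^α Y_u` under the linear map `x ↦ x Y⁻¹` (`multiIterate_pderiv_solution`). At each point
`ρ < R` the function `f ↦ |f(t_{a,ρ})|` is a non-archimedean absolute value of the field of
meromorphic functions (`meroAbs`), and `|∂^α f / α!| ≤ |f| ρ^{-α}` (`taylorBounded_mero`): this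
is visible on power series, because `∂^α / α!` multiplies coefficients by integers, and it passes
to quotients by the Leibniz rule.

The estimate is then a statement about `n` elements `v_j` of a field with commuting derivations
and such an absolute value (`linear_taylor_le`): a linear form `L` with `|L(∂^β v)| ρ^β ≤ M` for
`|β| < n` satisfies `|L(∂^α v / α!)| ρ^α ≤ M {|α|, n-1}_p` for all `α`. It is proved by induction
on `n`. If `y` is a nonzero entry of `v` and `z = v / y`, the Leibniz rule reduces the claim for `v`
to the claim for `z`. One entry of `z` is `1`, so each `∂_i z` has at most `n - 1` nonzero entries,
and `L` is controlled on `∂_i z` since it is controlled on `v`. Now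
`∂^γ z / γ! = γ_i⁻¹ ∂^{γ - 1_i} (∂_i z) / (γ - 1_i)!`, where `i` can be chosen with
`|γ_i| ≥ |∑ γ_j|`, and the resulting factor `1 / |s|`, `s = ∑ γ_j`, combines with
`{s - 1, n - 2}_p` to at most `{s, n - 1}_p` (`chainConst_mul_le`).

Working with a linear form instead of expressing `∂^α` through the `∂^β` with `|β| < n` avoids any
choice of coefficients and any assumption of linear independence over the constants. Finally the
estimate at `ρ` passes to the limit superior as `ρ → R`.
-/

namespace DworkRobba

open Finset MvPowerSeries

/-! ### The constants `{s, n}_p` -/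

section ChainConst

variable {p : ℕ} [Fact p.Prime]

/-- Fewer than `min n s` factors are allowed as well: additional factors only increase
`1 / |λ_1 ⋯ λ_m|_p`. -/
theorem inv_nnnorm_prod_le_chainConst {s n : ℕ} {T : Finset ℕ} (hT : T ⊆ Icc 1 s)
    (hn : #T ≤ n) : ‖((∏ j ∈ T, j : ℕ) : ℚ_[p])‖₊⁻¹ ≤ chainConst p s n := by
  have hs : #T ≤ s := by simpa using card_le_card hT
  obtain ⟨U, hTU, hU, hUc⟩ := exists_subsuperset_card_eq hT (le_min hn hs)
    (by simp : min n s ≤ #(Icc 1 s))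
  refine le_trans ?_ (le_sup (mem_powersetCard.2 ⟨hU, hUc⟩))
  have h0 : ((∏ j ∈ U, j : ℕ) : ℚ_[p]) ≠ 0 := by
    rw [Nat.cast_ne_zero, prod_ne_zero_iff]
    intro j hj
    have := mem_Icc.1 (hU hj)
    omega
  refine inv_anti₀ (by simpa only [pos_iff_ne_zero, ne_eq, nnnorm_eq_zero] using h0) ?_
  rw [← prod_sdiff hTU, Nat.cast_mul, nnnorm_mul]
  refine mul_le_of_le_one_left' ?_
  exact IsUltrametricDist.nnnorm_natCast_le_one ℚ_[p] _

theorem one_le_chainConst (s n : ℕ) : 1 ≤ chainConst p s n := by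
  simpa using inv_nnnorm_prod_le_chainConst (p := p) (s := s) (n := n) (empty_subset _) (by simp)

theorem chainConst_mono {s t : ℕ} (h : s ≤ t) (n : ℕ) : chainConst p s n ≤ chainConst p t n := by
  refine Finset.sup_le fun T hT => ?_
  obtain ⟨hT, hc⟩ := mem_powersetCard.1 hT
  exact inv_nnnorm_prod_le_chainConst (hT.trans (Icc_subset_Icc_right h))
    (hc.le.trans (min_le_left _ _))

/-- The factor `s + 1` can be added to any set of factors taken from `1, …, s`. -/
theorem chainConst_mul_le (s n : ℕ) :
    chainConst p s n * ‖((s + 1 : ℕ) : ℚ_[p])‖₊⁻¹ ≤ chainConst p (s + 1) (n + 1) := by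
  have hpos : ‖((s + 1 : ℕ) : ℚ_[p])‖₊ ≠ 0 := by
    rw [nnnorm_ne_zero_iff, Nat.cast_ne_zero]
    omega
  rw [← div_eq_mul_inv, div_le_iff₀ (pos_iff_ne_zero.2 hpos)]
  refine Finset.sup_le fun T hT => ?_
  obtain ⟨hT, hc⟩ := mem_powersetCard.1 hT
  have hs : s + 1 ∉ T := fun h => by
    have := mem_Icc.1 (hT h)
    omega
  rw [← div_le_iff₀ (pos_iff_ne_zero.2 hpos), div_eq_mul_inv, ← mul_inv, ← nnnorm_mul,
    ← Nat.cast_mul, mul_comm, ← prod_insert hs (f := fun j => j)]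
  refine inv_nnnorm_prod_le_chainConst (insert_subset (by simp) (hT.trans ?_)) ?_
  · exact Icc_subset_Icc_right s.le_succ
  · rw [card_insert_of_notMem hs, hc]
    exact Nat.succ_le_succ (min_le_left _ _)

end ChainConst

/-! ### Multi-indices -/

section MultiIndex

variable {d : ℕ}

theorem finsupp_add_single_induction {P : (Fin d →₀ ℕ) → Prop} (h0 : P 0)
    (hs : ∀ α i, P α → P (α + Finsupp.single i 1)) (α : Fin d →₀ ℕ) : P α := by
  have aux : ∀ (i : Fin d) (n : ℕ) (β), P β → P (β + Finsupp.single i n) := by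
    intro i n
    induction n with
    | zero => simp
    | succ n ih =>
      intro β hβ
      rw [Finsupp.single_add, ← add_assoc]
      exact hs _ i (ih β hβ)
  induction α using Finsupp.induction with
  | zero => exact h0
  | single_add i n β _ _ ih => simpa [add_comm] using aux i n β ih

/-- `α! = ∏ α_i!`. -/
def multiFactorial (α : Fin d → ℕ) : ℕ := ∏ i, (α i).factorial

/-- `ρ^α = ∏ ρ_i^{α_i}`. -/
def multiPow (ρ : Fin d → ℝ) (α : Fin d → ℕ) : ℝ := ∏ i, ρ i ^ α i

theorem multiFactorial_ne_zero (α : Fin d → ℕ) : multiFactorial α ≠ 0 :=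
  prod_ne_zero_iff.2 fun i _ => (α i).factorial_ne_zero

theorem multiFactorial_add_single (α : Fin d →₀ ℕ) (i : Fin d) :
    multiFactorial (α + Finsupp.single i 1 : Fin d →₀ ℕ) = (α i + 1) * multiFactorial α := by
  simp only [multiFactorial]
  rw [← mul_prod_erase _ _ (mem_univ i), ← mul_prod_erase univ (fun j => (α j).factorial)
    (mem_univ i), ← mul_assoc]
  congr 1
  · simp [Nat.factorial_succ]
  · refine prod_congr rfl fun j hj => ?_
    simp [(ne_of_mem_erase hj).symm]

theorem multiFactorial_dvd {α β : Fin d →₀ ℕ} (h : α ≤ β) : multiFactorial α ∣ multiFactorial β :=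
  prod_dvd_prod_of_dvd _ _ fun i _ => Nat.factorial_dvd_factorial (h i)

theorem multiFactorial_mul_dvd (α β : Fin d →₀ ℕ) :
    multiFactorial α * multiFactorial β ∣ multiFactorial (α + β : Fin d →₀ ℕ) := by
  simp only [multiFactorial, ← prod_mul_distrib]
  exact prod_dvd_prod_of_dvd _ _ fun i _ => Nat.factorial_mul_factorial_dvd_factorial_add _ _

theorem multiPow_pos {ρ : Fin d → ℝ} (hρ : ∀ i, 0 < ρ i) (α : Fin d → ℕ) : 0 < multiPow ρ α :=
  prod_pos fun i _ => pow_pos (hρ i) _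

theorem multiPow_add (ρ : Fin d → ℝ) (α β : Fin d →₀ ℕ) :
    multiPow ρ (α + β : Fin d →₀ ℕ) = multiPow ρ α * multiPow ρ β := by
  simp [multiPow, pow_add, prod_mul_distrib]

theorem multiPow_single (ρ : Fin d → ℝ) (i : Fin d) : multiPow ρ (Finsupp.single i 1) = ρ i := by
  rw [multiPow, prod_eq_single i]
  · simp
  · intro j _ hj
    simp [hj.symm]
  · simp

/-- Compose commuting self-maps `f i`, the `i`-th one `α i` times. -/
def multiIterate {X : Type*} (f : Fin d → X → X) (α : Fin d → ℕ) (x : X) : X :=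
  (List.finRange d).foldr (fun i y => (f i)^[α i] y) x

theorem multiIterate_zero {X : Type*} (f : Fin d → X → X) (x : X) :
    multiIterate f (0 : Fin d →₀ ℕ) x = x := by
  simp [multiIterate]

theorem multiIterate_add_single {X : Type*} {f : Fin d → X → X}
    (hf : ∀ i j, Function.Commute (f i) (f j)) (α : Fin d →₀ ℕ) (i : Fin d) (x : X) :
    multiIterate f (α + Finsupp.single i 1 : Fin d →₀ ℕ) x = f i (multiIterate f α x) := by
  have aux : ∀ l : List (Fin d), l.Nodup →
      l.foldr (fun j y => (f j)^[(α + Finsupp.single i 1 : Fin d →₀ ℕ) j] y) x =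
        if i ∈ l then f i (l.foldr (fun j y => (f j)^[α j] y) x)
        else l.foldr (fun j y => (f j)^[α j] y) x := by
    intro l
    induction l with
    | nil => simp
    | cons j l ih =>
      intro hl
      rw [List.nodup_cons] at hl
      simp only [List.foldr_cons, ih hl.2, List.mem_cons]
      rcases eq_or_ne i j with rfl | hij
      · simp [hl.1, Function.iterate_succ_apply']
      · by_cases hi : i ∈ l
        · simp only [hi, or_true, if_true, Finsupp.add_apply, Finsupp.single_eq_of_ne hij.symm,
            add_zero]
          exact ((hf i j).iterate_right (α j) _).symm
        · simp [hi, hij]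
  simpa [multiIterate] using aux (List.finRange d) (List.nodup_finRange d)

theorem multiIterate_add_single' {X : Type*} {f : Fin d → X → X}
    (hf : ∀ i j, Function.Commute (f i) (f j)) (α : Fin d →₀ ℕ) (i : Fin d) (x : X) :
    multiIterate f (α + Finsupp.single i 1 : Fin d →₀ ℕ) x = multiIterate f α (f i x) := by
  rw [multiIterate_add_single hf]
  induction α using finsupp_add_single_induction with
  | h0 => simp only [multiIterate_zero]
  | hs α j ih => rw [multiIterate_add_single hf, multiIterate_add_single hf, ← ih, hf i j]

end MultiIndex

/-! ### Taylor series in a differential field -/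

section Taylor

variable {k F : Type*} [Field k] [Field F] [Algebra k F] {d : ℕ}

/-- The Taylor series `∑ (∂^α f / α!) X^α` of an element `f` of a field with commuting
derivations `D i = ∂_i`. -/
noncomputable def taylor (D : Fin d → Derivation k F F) (f : F) : MvPowerSeries (Fin d) F :=
  fun α => (multiFactorial α : F)⁻¹ * multiIterate (fun i => D i) α f

variable {D : Fin d → Derivation k F F}

theorem coeff_taylor (f : F) (α : Fin d →₀ ℕ) :
    coeff α (taylor D f) = (multiFactorial α : F)⁻¹ * multiIterate (fun i => D i) α f := rfl

theorem coeff_zero_taylor (f : F) : coeff 0 (taylor D f) = f := by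
  rw [coeff_taylor, multiIterate_zero]
  simp [multiFactorial]

variable (hD : ∀ i j, Function.Commute (D i) (D j))
include hD

theorem taylor_add (f g : F) : taylor D (f + g) = taylor D f + taylor D g := by
  ext α
  rw [map_add, coeff_taylor, coeff_taylor, coeff_taylor, ← mul_add]
  congr 1
  induction α using finsupp_add_single_induction with
  | h0 => simp only [multiIterate_zero]
  | hs α i ih => simp only [multiIterate_add_single hD, ih, map_add]

theorem taylor_zero : taylor D 0 = 0 := by
  simpa using taylor_add hD 0 0

variable [CharZero F]

theorem pderiv_taylor (f : F) (i : Fin d) : pderiv F i (taylor D f) = taylor D (D i f) := by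
  ext α
  have h1 : (multiFactorial α : F) ≠ 0 := Nat.cast_ne_zero.2 (multiFactorial_ne_zero _)
  have h2 : (α i + 1 : F) ≠ 0 := Nat.cast_add_one_ne_zero _
  rw [coeff_pderiv, coeff_taylor, coeff_taylor, multiIterate_add_single' hD,
    multiFactorial_add_single]
  push_cast
  field_simp

theorem coeff_taylor_deriv (f : F) (i : Fin d) (α : Fin d →₀ ℕ) :
    coeff α (taylor D (D i f)) = (α i + 1) * coeff (α + Finsupp.single i 1) (taylor D f) := by
  rw [← pderiv_taylor hD, coeff_pderiv, mul_comm]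

/-- The Leibniz rule for all divided powers at once. Both sides have the same constant term, and
by the product rule for `∂_i` their partial derivatives are of the same shape, which gives the
coefficients of next higher degree. -/
theorem taylor_mul (f g : F) : taylor D (f * g) = taylor D f * taylor D g := by
  ext α
  induction α using finsupp_add_single_induction generalizing f g with
  | h0 => rw [coeff_zero_taylor, coeff_mul, Finsupp.antidiagonal_zero, sum_singleton,
      coeff_zero_taylor, coeff_zero_taylor]
  | hs α i ih =>
    have h2 : (α i + 1 : F) ≠ 0 := Nat.cast_add_one_ne_zero _
    apply mul_right_cancel₀ h2
    rw [← coeff_pderiv, ← coeff_pderiv, pderiv_taylor hD, Derivation.leibniz,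
      Derivation.leibniz, pderiv_taylor hD, pderiv_taylor hD]
    simp only [smul_eq_mul, taylor_add hD, map_add, ih]

end Taylor

/-! ### The Dwork–Robba estimate for one absolute value -/

section Estimate

theorem absoluteValue_sum_le {F ι : Type*} [Field F] {N : AbsoluteValue F ℝ}
    (hN : IsNonarchimedean N) {s : Finset ι} {f : ι → F} {C : ℝ} (hC : 0 ≤ C)
    (h : ∀ i ∈ s, N (f i) ≤ C) : N (∑ i ∈ s, f i) ≤ C := by
  classical
  induction s using Finset.induction_on with
  | empty => simpa using hC
  | insert a s ha ih =>
    rw [sum_insert ha]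
    exact (hN _ _).trans (max_le (h a (mem_insert_self _ _))
      (ih fun i hi => h i (mem_insert_of_mem hi)))

variable {k F : Type*} [Field k] [Field F] [Algebra k F] [CharZero F] {d : ℕ}
  {D : Fin d → Derivation k F F} (hD : ∀ i j, Function.Commute (D i) (D j))
  {N : AbsoluteValue F ℝ} (hN : IsNonarchimedean N) {ρ : Fin d → ℝ} (hρ : ∀ i, 0 < ρ i)

/-- The condition `|∂^α f / α!| ≤ |f| ρ^{-α}` for all `α`. -/
def TaylorBounded (D : Fin d → Derivation k F F) (N : AbsoluteValue F ℝ) (ρ : Fin d → ℝ)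
    (f : F) : Prop :=
  ∀ α, N (coeff α (taylor D f)) * multiPow ρ α ≤ N f

include hD hN hρ in
/-- The Taylor coefficients of a quotient `q = f / g` are found recursively from those of
`f = g q`. -/
theorem TaylorBounded.div {f g : F} (hf : TaylorBounded D N ρ f) (hg : TaylorBounded D N ρ g) :
    TaylorBounded D N ρ (f / g) := by
  rcases eq_or_ne g 0 with rfl | hg0
  · intro α
    simp [taylor_zero hD]
  intro α
  have hg1 : 0 < N g := N.pos hg0
  induction α using WellFoundedLT.induction with
  | ind α ih =>
    have hw := multiPow_pos hρ α
    have h := congrArg (coeff α) (taylor_mul hD g (f / g))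
    rw [mul_div_cancel₀ _ hg0, coeff_mul,
      ← add_sum_erase _ _ (show ((0 : Fin d →₀ ℕ), α) ∈ antidiagonal α by simp),
      coeff_zero_taylor, ← sub_eq_iff_eq_add, sub_eq_add_neg] at h
    have hsum : N (-∑ x ∈ (antidiagonal α).erase (0, α),
        coeff x.1 (taylor D g) * coeff x.2 (taylor D (f / g))) ≤ N f / multiPow ρ α := by
      rw [AbsoluteValue.map_neg]
      refine absoluteValue_sum_le hN (div_nonneg (N.nonneg _) hw.le) fun x hx => ?_
      obtain ⟨hne, hx⟩ := mem_erase.1 hx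
      rw [HasAntidiagonal.mem_antidiagonal] at hx
      have hlt : x.2 < α := by
        refine lt_of_le_of_ne (hx ▸ le_add_self) fun h => hne (Prod.ext ?_ h)
        simpa [h] using hx
      rw [le_div_iff₀ hw, map_mul, ← hx, multiPow_add, mul_mul_mul_comm]
      calc _ ≤ N g * N (f / g) := mul_le_mul (hg _) (ih _ hlt)
            (mul_nonneg (N.nonneg _) (multiPow_pos hρ _).le) (N.nonneg _)
        _ = N f := by rw [← map_mul, mul_div_cancel₀ _ hg0]
    have hmain : N (g * coeff α (taylor D (f / g))) ≤ N f / multiPow ρ α := by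
      rw [← h]
      exact (hN _ _).trans (max_le ((le_div_iff₀ hw).2 (hf α)) hsum)
    rw [map_mul, le_div_iff₀ hw] at hmain
    rw [map_div₀, le_div_iff₀ hg1]
    linarith

variable {ι : Type*} (hT : ∀ f, TaylorBounded D N ρ f)

include hD hN hρ hT

/-- Multiplying all the functions by `f` scales bounds on their divided derivatives by `|f|`. -/
theorem linear_taylor_smul_le (L : (ι → F) →ₗ[F] F) (f : F) (z : ι → F) (α : Fin d →₀ ℕ) {K : ℝ}
    (hK : 0 ≤ K) (h : ∀ γ ≤ α, N (L fun j => coeff γ (taylor D (z j))) * multiPow ρ γ ≤ K) :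
    N (L fun j => coeff α (taylor D (f * z j))) * multiPow ρ α ≤ N f * K := by
  have hw := multiPow_pos hρ α
  have e : (fun j => coeff α (taylor D (f * z j))) = ∑ x ∈ antidiagonal α,
      coeff x.1 (taylor D f) • fun j => coeff x.2 (taylor D (z j)) := by
    ext j
    simp [taylor_mul hD, coeff_mul]
  rw [e, map_sum, ← le_div_iff₀ hw]
  refine absoluteValue_sum_le hN (div_nonneg (mul_nonneg (N.nonneg _) hK) hw.le) fun x hx => ?_
  rw [HasAntidiagonal.mem_antidiagonal] at hx
  rw [le_div_iff₀ hw, map_smul, smul_eq_mul, map_mul, ← hx, multiPow_add, mul_mul_mul_comm]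
  exact mul_le_mul (hT f _) (h _ (hx ▸ le_add_self))
    (mul_nonneg (N.nonneg _) (multiPow_pos hρ _).le) (N.nonneg _)

/-- The analogue of `linear_taylor_smul_le` for the derivatives `∂^α` in place of `∂^α / α!`. -/
theorem linear_taylor_smul_le' (L : (ι → F) →ₗ[F] F) (f : F) (z : ι → F) (α : Fin d →₀ ℕ) {K : ℝ}
    (hK : 0 ≤ K) (h : ∀ γ ≤ α, N (multiFactorial γ : F) *
      (N (L fun j => coeff γ (taylor D (z j))) * multiPow ρ γ) ≤ K) :
    N (multiFactorial α : F) *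
      (N (L fun j => coeff α (taylor D (f * z j))) * multiPow ρ α) ≤ N f * K := by
  have hpos : ∀ β : Fin d →₀ ℕ, 0 < N (multiFactorial β : F) := fun β =>
    N.pos (Nat.cast_ne_zero.2 (multiFactorial_ne_zero _))
  have := linear_taylor_smul_le hD hN hρ hT L f z α (div_nonneg hK (hpos α).le) fun γ hγ => by
    rw [le_div_iff₀' (hpos α)]
    refine (mul_le_mul_of_nonneg_right ?_
      (mul_nonneg (N.nonneg _) (multiPow_pos hρ _).le)).trans (h γ hγ)
    obtain ⟨m, hm⟩ := multiFactorial_dvd hγ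
    rw [hm, Nat.cast_mul, map_mul]
    exact mul_le_of_le_one_right (N.nonneg _) hN.apply_natCast_le_one
  rw [← mul_div_assoc, le_div_iff₀' (hpos α)] at this
  exact this

/-- The Dwork–Robba estimate, in dual form: an `F`-linear form `L` on vectors of `n` functions
which is controlled on the derivatives of `v` of order less than `n` is controlled on all
divided derivatives of `v`. In the induction on `n` one divides `v` by a nonzero entry; each
derivative `∂_i` of the quotient has one nonzero entry less. To pass from `∂_i z` to
`∂^γ z / γ!` costs a factor `1 / |γ_i|`, and for a suitable `i` this is at most `1 / |s|` with
`s = ∑ γ_i`. -/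
theorem linear_taylor_le {p : ℕ} [Fact p.Prime] (hNp : ∀ m : ℕ, N (m : F) = ‖(m : ℚ_[p])‖)
    [Fintype ι] (n : ℕ) (v : ι → F) [DecidablePred fun j => v j ≠ 0] (hv : #{j | v j ≠ 0} ≤ n)
    (L : (ι → F) →ₗ[F] F) {M : ℝ} (hM : 0 ≤ M)
    (h : ∀ β : Fin d →₀ ℕ, β.degree < n → N (multiFactorial β : F) *
      (N (L fun j => coeff β (taylor D (v j))) * multiPow ρ β) ≤ M) (α : Fin d →₀ ℕ) :
    N (L fun j => coeff α (taylor D (v j))) * multiPow ρ α ≤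
      M * chainConst p α.degree (n - 1) := by
  classical
  induction n generalizing v M α with
  | zero =>
    have hv0 : ∀ j, v j = 0 := by simpa [filter_eq_empty_iff] using hv
    have : (fun j => coeff α (taylor D (v j))) = 0 := by
      ext j
      simp [hv0, taylor_zero hD]
    rw [this, map_zero, map_zero, zero_mul]
    positivity
  | succ n ih =>
    by_cases hv0 : ∀ j, v j = 0
    · have : (fun j => coeff α (taylor D (v j))) = 0 := by
        ext j
        simp [hv0, taylor_zero hD]
      rw [this, map_zero, map_zero, zero_mul]
      positivity
    push Not at hv0
    obtain ⟨j₀, hj₀⟩ := hv0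
    set y := v j₀ with hy
    have hNy : 0 < N y := N.pos hj₀
    set z : ι → F := fun j => y⁻¹ * v j with hz
    have hvz : ∀ j, v j = y * z j := fun j => by rw [hz]; field_simp
    -- The derivatives of `z` of order at most `n` are controlled like those of `v`.
    have hz1 : ∀ β : Fin d →₀ ℕ, β.degree < n + 1 → N (multiFactorial β : F) *
        (N (L fun j => coeff β (taylor D (z j))) * multiPow ρ β) ≤ (N y)⁻¹ * M := by
      intro β hβ
      have := linear_taylor_smul_le' hD hN hρ hT L y⁻¹ v β hM fun γ hγ =>
        h γ ((Finsupp.degree_mono hγ).trans_lt hβ)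
      rwa [map_inv₀] at this
    have hM' : 0 ≤ (N y)⁻¹ * M := by positivity
    have key : ∀ γ : Fin d →₀ ℕ, N (L fun j => coeff γ (taylor D (z j))) * multiPow ρ γ ≤
        (N y)⁻¹ * M * chainConst p γ.degree n := by
      intro γ
      rcases eq_or_ne γ 0 with rfl | hγ
      · have h0 := hz1 0 (by simp)
        have : multiFactorial (0 : Fin d →₀ ℕ) = 1 := by simp [multiFactorial]
        rw [this, Nat.cast_one, map_one, one_mul] at h0
        refine h0.trans (le_mul_of_one_le_right hM' ?_)
        exact_mod_cast one_le_chainConst (p := p) _ _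
      have hdeg : γ.degree ≠ 0 := by rwa [ne_eq, Finsupp.degree_eq_zero_iff]
      have hsum : (γ.degree : F) = ∑ i, (γ i : F) := by
        rw [Finsupp.degree_eq_sum, Nat.cast_sum]
      obtain ⟨i, hi⟩ : ∃ i, N (γ.degree : F) ≤ N (γ i : F) := by
        have hne : (univ : Finset (Fin d)).Nonempty := by
          obtain ⟨i, -⟩ := Finsupp.ne_iff.1 hγ
          exact ⟨i, mem_univ i⟩
        obtain ⟨i, -, hi⟩ := exists_max_image univ (fun i => N (γ i : F)) hne
        exact ⟨i, hsum ▸ absoluteValue_sum_le hN (N.nonneg _) hi⟩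
      have hpos : 0 < N (γ.degree : F) := N.pos (Nat.cast_ne_zero.2 hdeg)
      have hγi : γ i ≠ 0 := fun h0 => by
        rw [h0] at hi
        simp only [Nat.cast_zero, map_zero] at hi
        exact absurd hi (not_le.2 hpos)
      obtain ⟨δ, rfl⟩ : ∃ δ, γ = δ + Finsupp.single i 1 :=
        ⟨γ - Finsupp.single i 1, (tsub_add_cancel_of_le (by
          rw [Finsupp.single_le_iff]; omega)).symm⟩
      have hδ : (δ + Finsupp.single i 1).degree = δ.degree + 1 := by simp
      have hcast : (((δ + Finsupp.single i 1 : Fin d →₀ ℕ) i : ℕ) : F) = δ i + 1 := by simp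
      rw [hcast, hδ] at hi
      rw [hδ] at hpos ⊢
      set z' : ι → F := fun j => D i (z j) with hz'
      have hL : ∀ β : Fin d →₀ ℕ, (L fun j => coeff β (taylor D (z' j))) =
          (β i + 1) * L fun j => coeff (β + Finsupp.single i 1) (taylor D (z j)) := by
        intro β
        rw [← smul_eq_mul, ← map_smul]
        congr 1
        ext j
        simp [hz', coeff_taylor_deriv hD]
      have hsub : univ.filter (fun j => z' j ≠ 0) ⊆ (univ.filter fun j => v j ≠ 0).erase j₀ := by
        intro j hj
        rw [mem_filter] at hj
        simp only [mem_erase, mem_filter, mem_univ, true_and]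
        refine ⟨?_, ?_⟩
        · rintro rfl
          refine hj.2 ?_
          show D i (y⁻¹ * y) = 0
          rw [inv_mul_cancel₀ hj₀, Derivation.map_one_eq_zero]
        · intro h0
          refine hj.2 ?_
          simp [hz', hz, h0]
      have hcard : #{j | z' j ≠ 0} ≤ n := by
        refine (card_le_card hsub).trans ?_
        rw [card_erase_of_mem (by simpa [hy] using hj₀)]
        omega
      have step := ih z' hcard (M := (N y)⁻¹ * M / ρ i) (div_nonneg hM' (hρ i).le)
        (fun β hβ => by
          have := hz1 (β + Finsupp.single i 1) (by simpa using hβ)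
          rw [multiFactorial_add_single, multiPow_add, multiPow_single] at this
          push_cast at this
          rw [le_div_iff₀ (hρ i), hL, map_mul]
          rw [map_mul] at this
          linarith) δ
      rw [hL, map_mul, div_mul_eq_mul_div, le_div_iff₀ (hρ i)] at step
      rw [multiPow_add, multiPow_single]
      rcases Nat.eq_zero_or_pos n with rfl | hn
      · -- With no nonzero entry left the bound is `0`, and no factor `1 / |s|` appears.
        have hz0 : ∀ j, z' j = 0 := by simpa [filter_eq_empty_iff] using hcard
        have h0 := hL δ
        have : (fun j => coeff δ (taylor D (z' j))) = 0 := by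
          ext j
          simp [hz0, taylor_zero hD]
        rw [this, map_zero, eq_comm, mul_eq_zero] at h0
        rw [h0.resolve_left (Nat.cast_add_one_ne_zero _), map_zero, zero_mul]
        positivity
      obtain ⟨m, rfl⟩ : ∃ m, n = m + 1 := ⟨n - 1, by omega⟩
      rw [Nat.add_sub_cancel] at step
      have hch : (chainConst p δ.degree m : ℝ) ≤
          chainConst p (δ.degree + 1) (m + 1) * N ((δ.degree + 1 : ℕ) : F) := by
        have := chainConst_mul_le (p := p) δ.degree m
        rw [← NNReal.coe_le_coe] at this
        push_cast at this
        rw [hNp, ← div_le_iff₀ (by rwa [hNp] at hpos), div_eq_mul_inv]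
        exact_mod_cast this
      set A := N (L fun j => coeff (δ + Finsupp.single i 1) (taylor D (z j))) *
        (multiPow ρ δ * ρ i) with hA
      have hA0 : 0 ≤ A := mul_nonneg (N.nonneg _) (mul_nonneg (multiPow_pos hρ _).le (hρ i).le)
      have : A * N ((δ.degree + 1 : ℕ) : F) ≤
          (N y)⁻¹ * M * chainConst p (δ.degree + 1) (m + 1) * N ((δ.degree + 1 : ℕ) : F) := by
        calc _ ≤ A * N (δ i + 1 : F) := mul_le_mul_of_nonneg_left hi hA0
          _ ≤ (N y)⁻¹ * M * chainConst p δ.degree m := by rw [hA]; linarith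
          _ ≤ _ := by
            rw [mul_assoc _ _ (N _)]
            exact mul_le_mul_of_nonneg_left hch hM'
      exact le_of_mul_le_mul_right this hpos
    have hfin := linear_taylor_smul_le hD hN hρ hT L y z α
      (K := (N y)⁻¹ * M * chainConst p α.degree n) (by positivity) fun γ hγ =>
        (key γ).trans (mul_le_mul_of_nonneg_left (NNReal.coe_le_coe.2
          (chainConst_mono (Finsupp.degree_mono hγ) n)) hM')
    simp only [← hvz] at hfin
    rw [← mul_assoc, ← mul_assoc, mul_inv_cancel₀ hNy.ne', one_mul] at hfin
    simpa using hfin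

end Estimate

end DworkRobba

namespace DworkRobba

/-! ### The maximal points as absolute values -/

section Mero

variable {k : Type*} [NormedField k] [IsUltrametricDist k] {d : ℕ} {a : Fin d → k}
  {r ρ : Fin d → ℝ}

theorem Mero.exists_eq_div (x : Mero a r) : ∃ f g : Hol a r, g ≠ 0 ∧
    x = algebraMap (Hol a r) (Mero a r) f / algebraMap (Hol a r) (Mero a r) g := by
  obtain ⟨f, g, hg, rfl⟩ := IsFractionRing.div_surjective (Hol a r) x
  exact ⟨f, g, nonZeroDivisors.ne_zero hg, rfl⟩

theorem Mero.algebraMap_ne_zero {f : Hol a r} (hf : f ≠ 0) :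
    algebraMap (Hol a r) (Mero a r) f ≠ 0 :=
  (map_ne_zero_iff _ (IsFractionRing.injective (Hol a r) (Mero a r))).2 hf

theorem meroNorm_nonneg (x : Mero a r) : 0 ≤ meroNorm ρ x :=
  div_nonneg (MvPowerSeries.gaussNorm_nonneg _ _ _ norm_nonneg)
    (MvPowerSeries.gaussNorm_nonneg _ _ _ norm_nonneg)

section

variable (hρ : ∀ i, 0 < ρ i ∧ ρ i < r i)
include hρ

theorem holNorm_pos {f : Hol a r} (hf : f ≠ 0) : 0 < holNorm ρ f :=
  gaussNorm_pos (fun i => (hρ i).1) (f.2 ρ hρ) fun h => hf (Subtype.ext h)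

theorem holNorm_mul (f g : Hol a r) : holNorm ρ (f * g) = holNorm ρ f * holNorm ρ g :=
  gaussNorm_mul (fun i => (hρ i).1) (f.2 ρ hρ) (g.2 ρ hρ)

theorem holNorm_add_le (f g : Hol a r) : holNorm ρ (f + g) ≤ max (holNorm ρ f) (holNorm ρ g) :=
  MvPowerSeries.gaussNorm_add_le_max _ _ f.1 g.1 (fun i => (hρ i).1.le) norm_nonneg
    IsUltrametricDist.norm_add_le_max (hasGaussNorm_of_isRestricted (f.2 ρ hρ))
    (hasGaussNorm_of_isRestricted (g.2 ρ hρ))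

theorem meroNorm_mul (x y : Mero a r) : meroNorm ρ (x * y) = meroNorm ρ x * meroNorm ρ y := by
  obtain ⟨f, g, hg, rfl⟩ := x.exists_eq_div
  obtain ⟨f', g', hg', rfl⟩ := y.exists_eq_div
  rw [div_mul_div_comm, ← map_mul, ← map_mul, meroNorm_div hρ _ _ hg, meroNorm_div hρ _ _ hg',
    meroNorm_div hρ _ _ (mul_ne_zero hg hg'), holNorm_mul hρ, holNorm_mul hρ, div_mul_div_comm]

theorem meroNorm_add_le (x y : Mero a r) :
    meroNorm ρ (x + y) ≤ max (meroNorm ρ x) (meroNorm ρ y) := by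
  obtain ⟨f, g, hg, rfl⟩ := x.exists_eq_div
  obtain ⟨f', g', hg', rfl⟩ := y.exists_eq_div
  have h1 := holNorm_pos hρ hg
  have h2 := holNorm_pos hρ hg'
  have h3 : algebraMap (Hol a r) (Mero a r) g ≠ 0 := Mero.algebraMap_ne_zero hg
  have h4 : algebraMap (Hol a r) (Mero a r) g' ≠ 0 := Mero.algebraMap_ne_zero hg'
  rw [div_add_div _ _ h3 h4, ← map_mul,
    ← map_mul, ← map_mul, ← map_add, meroNorm_div hρ _ _ hg, meroNorm_div hρ _ _ hg',
    meroNorm_div hρ _ _ (mul_ne_zero hg hg'), holNorm_mul hρ g g']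
  have := holNorm_add_le hρ (f * g') (g * f')
  rw [holNorm_mul hρ, holNorm_mul hρ] at this
  rcases le_max_iff.1 this with h | h
  · refine le_max_of_le_left ?_
    rw [div_le_div_iff₀ (mul_pos h1 h2) h1]
    nlinarith
  · refine le_max_of_le_right ?_
    rw [div_le_div_iff₀ (mul_pos h1 h2) h2]
    nlinarith

theorem meroNorm_eq_zero (x : Mero a r) : meroNorm ρ x = 0 ↔ x = 0 := by
  obtain ⟨f, g, hg, rfl⟩ := x.exists_eq_div
  rw [meroNorm_div hρ _ _ hg, div_eq_zero_iff, div_eq_zero_iff]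
  rcases eq_or_ne f 0 with rfl | hf
  · have : holNorm ρ (0 : Hol a r) = 0 := MvPowerSeries.gaussNorm_zero _ _ norm_zero
    simp [this]
  · simp [(holNorm_pos hρ hf).ne', (holNorm_pos hρ hg).ne', hf, hg]

end

/-- The maximal point `t_{a,ρ}`, as an absolute value of the field of meromorphic functions. -/
noncomputable def meroAbs (hρ : ∀ i, 0 < ρ i ∧ ρ i < r i) : AbsoluteValue (Mero a r) ℝ where
  toFun := meroNorm ρ
  map_mul' := meroNorm_mul hρ
  nonneg' := meroNorm_nonneg
  eq_zero' := meroNorm_eq_zero hρ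
  add_le' x y := (meroNorm_add_le hρ x y).trans
    (max_le_add_of_nonneg (meroNorm_nonneg x) (meroNorm_nonneg y))

variable (hρ : ∀ i, 0 < ρ i ∧ ρ i < r i)

theorem meroAbs_isNonarchimedean : IsNonarchimedean (meroAbs (a := a) hρ) := meroNorm_add_le hρ

include hρ in
theorem holNorm_algebraMap (c : k) : holNorm ρ (algebraMap k (Hol a r) c) = ‖c‖ := by
  have hc : (algebraMap k (Hol a r) c).1 = MvPowerSeries.C c := rfl
  refine le_antisymm (ciSup_le fun t => ?_) ?_
  · classical
    rw [hc, MvPowerSeries.coeff_C]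
    split_ifs with h
    · simp [h]
    · simp
  · have := MvPowerSeries.le_gaussNorm _ _ _
      (hasGaussNorm_of_isRestricted ((algebraMap k (Hol a r) c).2 ρ hρ)) 0
    rw [hc, MvPowerSeries.coeff_C] at this
    simpa [holNorm, hc] using this

theorem meroAbs_algebraMap (f : Hol a r) :
    meroAbs hρ (algebraMap (Hol a r) (Mero a r) f) = holNorm ρ f := by
  have h1 : holNorm ρ (1 : Hol a r) = 1 := by
    simpa using holNorm_algebraMap hρ (a := a) 1
  have := meroNorm_div hρ f 1 one_ne_zero
  rw [map_one, div_one, h1, div_one] at this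
  exact this

theorem meroAbs_natCast (m : ℕ) : meroAbs (a := a) hρ (m : Mero a r) = ‖(m : k)‖ := by
  have := holNorm_algebraMap hρ (a := a) (m : k)
  rw [← meroAbs_algebraMap, map_natCast, map_natCast] at this
  exact this

instance [CharZero k] : CharZero (Mero a r) :=
  charZero_of_injective_algebraMap (algebraMap k (Mero a r)).injective

theorem Mero.pderiv_commute (i j : Fin d) :
    Function.Commute (Mero.pderiv a r i) (Mero.pderiv a r j) :=
  Mero.pderiv_comm a r i j

/-- The derivatives of `∑ c_β X^β` are given by `∂^α X^{α+β} = ((α+β)! / β!) X^β`. -/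
theorem exists_multiIterate_pderiv_eq (f : Hol a r) (α : Fin d →₀ ℕ) : ∃ g : Hol a r,
    multiIterate (fun i => Mero.pderiv a r i) α (algebraMap (Hol a r) (Mero a r) f) =
      algebraMap (Hol a r) (Mero a r) g ∧
    ∀ β : Fin d →₀ ℕ, MvPowerSeries.coeff β g.1 * multiFactorial β =
      multiFactorial (α + β : Fin d →₀ ℕ) * MvPowerSeries.coeff (α + β) f.1 := by
  induction α using finsupp_add_single_induction with
  | h0 => exact ⟨f, multiIterate_zero _ _, fun β => by rw [zero_add, mul_comm]⟩
  | hs α i ih =>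
    obtain ⟨g, hg, hc⟩ := ih
    refine ⟨Hol.pderiv a r i g, ?_, fun β => ?_⟩
    · rw [multiIterate_add_single Mero.pderiv_commute, hg]
      exact fracDeriv_algebraMap _ _
    · have h := hc (β + Finsupp.single i 1)
      rw [multiFactorial_add_single] at h
      have e : α + Finsupp.single i 1 + β = α + (β + Finsupp.single i 1) := by abel
      rw [e, ← h]
      show MvPowerSeries.coeff β (MvPowerSeries.pderiv k i g.1) * _ = _
      rw [MvPowerSeries.coeff_pderiv]
      push_cast
      ring

variable [CharZero k]

theorem taylorBounded_algebraMap (f : Hol a r) :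
    TaylorBounded (Mero.pderiv a r) (meroAbs hρ) ρ (algebraMap (Hol a r) (Mero a r) f) := by
  intro α
  have hρ0 : ∀ i, 0 < ρ i := fun i => (hρ i).1
  obtain ⟨g, hg, hc⟩ := exists_multiIterate_pderiv_eq f α
  have hα : 0 < ‖(multiFactorial α : k)‖ :=
    norm_pos_iff.2 (Nat.cast_ne_zero.2 (multiFactorial_ne_zero _))
  have hw := multiPow_pos hρ0 α
  rw [coeff_taylor, hg, map_mul, map_inv₀, meroAbs_natCast, meroAbs_algebraMap,
    meroAbs_algebraMap, inv_mul_eq_div, div_mul_eq_mul_div, div_le_iff₀ hα, ← le_div_iff₀ hw]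
  refine ciSup_le fun β => ?_
  have hβ : 0 < ‖(multiFactorial β : k)‖ :=
    norm_pos_iff.2 (Nat.cast_ne_zero.2 (multiFactorial_ne_zero _))
  have hprod : ∀ γ : Fin d →₀ ℕ, γ.prod (ρ · ^ ·) = multiPow ρ γ := fun γ =>
    Finsupp.prod_fintype _ _ (by simp)
  have hle := MvPowerSeries.le_gaussNorm _ _ _ (hasGaussNorm_of_isRestricted (f.2 ρ hρ)) (α + β)
  rw [hprod, multiPow_add] at hle
  rw [hprod, le_div_iff₀ hw]
  have hn := congrArg norm (hc β)
  obtain ⟨m, hm⟩ := multiFactorial_mul_dvd α β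
  have hm1 : ‖(m : k)‖ ≤ 1 := IsUltrametricDist.norm_natCast_le_one k m
  rw [hm, norm_mul, norm_mul] at hn
  push_cast at hn
  rw [norm_mul, norm_mul] at hn
  have hn' : ‖MvPowerSeries.coeff β g.1‖ =
      ‖(multiFactorial α : k)‖ * ‖(m : k)‖ * ‖MvPowerSeries.coeff (α + β) f.1‖ := by
    apply mul_right_cancel₀ hβ.ne'
    rw [hn]
    ring
  show ‖MvPowerSeries.coeff β g.1‖ * _ * _ ≤ _
  rw [hn']
  calc _ = ‖(m : k)‖ * (‖MvPowerSeries.coeff (α + β) f.1‖ * (multiPow ρ α * multiPow ρ β)) *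
        ‖(multiFactorial α : k)‖ := by ring
    _ ≤ 1 * holNorm ρ f * ‖(multiFactorial α : k)‖ := by
      refine mul_le_mul_of_nonneg_right ?_ hα.le
      refine mul_le_mul hm1 hle ?_ zero_le_one
      exact mul_nonneg (norm_nonneg _) (mul_nonneg hw.le (multiPow_pos hρ0 _).le)
    _ = _ := by rw [one_mul]

theorem taylorBounded_mero (x : Mero a r) :
    TaylorBounded (Mero.pderiv a r) (meroAbs hρ) ρ x := by
  obtain ⟨f, g, -, rfl⟩ := x.exists_eq_div
  exact TaylorBounded.div (k := k) (F := Mero a r) (D := Mero.pderiv a r) (N := meroAbs hρ)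
    Mero.pderiv_commute (meroAbs_isNonarchimedean hρ) (fun i => (hρ i).1)
    (taylorBounded_algebraMap hρ f) (taylorBounded_algebraMap hρ g)

end Mero

/-! ### Iterates of a system with a solution matrix -/

section Solution

variable {k : Type*} [NormedField k] [IsUltrametricDist k] {d : ℕ} {a : Fin d → k}
  {r R : Fin d → ℝ}

theorem Mero.restrict_algebraMap (h : ∀ i, R i ≤ r i) (f : Hol a r) :
    Mero.restrict a h (algebraMap (Hol a r) (Mero a r) f) =
      algebraMap (Hol a R) (Mero a R) (Subalgebra.inclusion (Hol.mono a h) f) := by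
  rw [Mero.restrict, IsFractionRing.map, IsLocalization.map_eq]
  rfl

theorem map_derivation_div {k F F' : Type*} [Field k] [Field F] [Field F'] [Algebra k F]
    [Algebra k F'] (φ : F →+* F') (D : Derivation k F F) (D' : Derivation k F' F') {x y : F}
    (hx : φ (D x) = D' (φ x)) (hy : φ (D y) = D' (φ y)) : φ (D (x / y)) = D' (φ (x / y)) := by
  rw [Derivation.leibniz_div, map_div₀, Derivation.leibniz_div]
  simp only [smul_eq_mul, map_sub, map_mul, map_pow, map_inv₀, hx, hy]

theorem Mero.restrict_pderiv (h : ∀ i, R i ≤ r i) (i : Fin d) (x : Mero a r) :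
    Mero.restrict a h (Mero.pderiv a r i x) = Mero.pderiv a R i (Mero.restrict a h x) := by
  have hol : ∀ f : Hol a r, Mero.restrict a h (Mero.pderiv a r i (algebraMap _ _ f)) =
      Mero.pderiv a R i (Mero.restrict a h (algebraMap _ _ f)) := by
    intro f
    rw [Mero.restrict_algebraMap]
    simp only [Mero.pderiv, fracDeriv_algebraMap]
    rw [Mero.restrict_algebraMap]
    rfl
  obtain ⟨f, g, -, rfl⟩ := x.exists_eq_div
  exact map_derivation_div _ _ _ (hol f) (hol g)

variable {μ : ℕ}

/-- For a solution matrix `Y` one has `∂^α Y = G_α Y`. -/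
theorem multiIterate_pderiv_solution (hRr : ∀ i, R i ≤ r i)
    {G : Fin d → Matrix (Fin μ) (Fin μ) (Mero a r)} (hG : IsIntegrable G)
    (Y : Matrix (Fin μ) (Fin μ) (Mero a R))
    (hY : ∀ i, matPderiv i Y = (G i).map (Mero.restrict a hRr) * Y) (α : Fin d →₀ ℕ) :
    Y.map (multiIterate (fun i => Mero.pderiv a R i) α) =
      (iterG G α).map (Mero.restrict a hRr) * Y := by
  induction α using finsupp_add_single_induction with
  | h0 =>
    have : iterG G ((0 : Fin d →₀ ℕ) : Fin d → ℕ) = 1 := by simp [iterG]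
    rw [this, Matrix.map_one _ (map_zero _) (map_one _), one_mul]
    ext u v
    exact multiIterate_zero _ _
  | hs α i ih =>
    have e1 : Y.map (multiIterate (fun i => Mero.pderiv a R i)
        (α + Finsupp.single i 1 : Fin d →₀ ℕ)) =
        matPderiv i (Y.map (multiIterate (fun i => Mero.pderiv a R i) α)) := by
      ext u v
      exact multiIterate_add_single Mero.pderiv_commute _ _ _
    have e2 : ((α + Finsupp.single i 1 : Fin d →₀ ℕ) : Fin d → ℕ) =
        (α : Fin d → ℕ) + Pi.single i 1 := by
      rw [Finsupp.coe_add, Finsupp.single_eq_pi_single]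
    have e3 : (matPderiv i (iterG G α)).map (Mero.restrict a hRr) =
        matPderiv i ((iterG G α).map (Mero.restrict a hRr)) := by
      ext u v
      exact Mero.restrict_pderiv hRr _ _
    rw [e1, ih, matPderiv_mul, hY, e2, iterG_succ hG,
      Matrix.map_add _ (Mero.restrict a hRr).map_add, e3, Matrix.map_mul, add_mul, mul_assoc]

/-- The Dwork–Robba estimate for the system at a single maximal point `t_{a,ρ}`: the row
`G_{α, u}` is the image of the row `∂^α Y_u` under the linear map `x ↦ x Y⁻¹`. -/
theorem meroNorm_iterG_le {p : ℕ} [Fact p.Prime] [NormedAlgebra ℚ_[p] k] (hRr : ∀ i, R i ≤ r i)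
    {G : Fin d → Matrix (Fin μ) (Fin μ) (Mero a r)} (hG : IsIntegrable G)
    (Y : GL (Fin μ) (Mero a R))
    (hY : ∀ i, matPderiv i Y.1 = (G i).map (Mero.restrict a hRr) * Y.1)
    {ρ : Fin d → ℝ} (hρ : ∀ i, 0 < ρ i ∧ ρ i < R i) {M : ℝ} (hM : 0 ≤ M) (u w : Fin μ)
    (h : ∀ β : Fin d →₀ ℕ, β.degree < μ →
      meroNorm ρ (Mero.restrict a hRr (iterG G β u w)) * multiPow ρ β ≤ M) (α : Fin d →₀ ℕ) :
    meroNorm ρ (Mero.restrict a hRr (iterGDiv G α u w)) * multiPow ρ α ≤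
      M * chainConst p α.degree (μ - 1) := by
  classical
  have : CharZero k := charZero_of_injective_algebraMap (algebraMap ℚ_[p] k).injective
  set Z : Matrix (Fin μ) (Fin μ) (Mero a R) := (Y⁻¹).1 with hZ
  set L : (Fin μ → Mero a R) →ₗ[Mero a R] Mero a R :=
    (LinearMap.proj w) ∘ₗ Matrix.vecMulLinear Z with hLdef
  have hL : ∀ β : Fin d →₀ ℕ,
      (L fun j => MvPowerSeries.coeff β (taylor (Mero.pderiv a R) (Y.1 u j))) =
        (multiFactorial β : Mero a R)⁻¹ * Mero.restrict a hRr (iterG G β u w) := by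
    intro β
    have hs := multiIterate_pderiv_solution hRr hG Y.1 hY β
    have hs' : (iterG G β).map (Mero.restrict a hRr) =
        Y.1.map (multiIterate (fun i => Mero.pderiv a R i) β) * Z := by
      rw [hs, mul_assoc, hZ, ← Units.val_mul, mul_inv_cancel, Units.val_one, mul_one]
    have hs'' := congrFun (congrFun hs' u) w
    rw [Matrix.map_apply] at hs''
    rw [hs'', Matrix.mul_apply, Finset.mul_sum]
    show ∑ j : Fin μ, _ * _ = _
    refine Finset.sum_congr rfl fun j _ => ?_
    rw [coeff_taylor, mul_assoc]
    rfl
  have hDiv : Mero.restrict a hRr (iterGDiv G α u w) =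
      (multiFactorial α : Mero a R)⁻¹ * Mero.restrict a hRr (iterG G α u w) := by
    simp [iterGDiv, multiFactorial]
  have main := linear_taylor_le (D := Mero.pderiv a R) Mero.pderiv_commute
    (meroAbs_isNonarchimedean hρ) (fun i => (hρ i).1) (taylorBounded_mero hρ) (p := p)
    (fun m => by
      rw [meroAbs_natCast, ← map_natCast (algebraMap ℚ_[p] k), norm_algebraMap'])
    μ (Y.1 u) (by simpa using Finset.card_filter_le Finset.univ fun j => Y.1 u j ≠ 0) L hM
    (fun β hβ => by
      refine le_of_eq_of_le ?_ (h β hβ)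
      have : (multiFactorial β : Mero a R) ≠ 0 := Nat.cast_ne_zero.2 (multiFactorial_ne_zero _)
      rw [hL, ← mul_assoc, ← map_mul, mul_inv_cancel_left₀ this]
      rfl) α
  rw [hL, ← hDiv] at main
  exact main

end Solution

/-! ### Passing to the boundary -/

section Boundary

variable {k : Type*} [NormedField k] [IsUltrametricDist k] {d : ℕ} {a : Fin d → k}
  {R : Fin d → ℝ}

theorem tendsto_multiPow (β : Fin d → ℕ) (s : Set (Fin d → ℝ)) :
    Tendsto (fun ρ => multiPow ρ β) (𝓝[s] R) (𝓝 (multiPow R β)) := by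
  have : Continuous fun ρ : Fin d → ℝ => multiPow ρ β := by
    unfold multiPow
    fun_prop
  exact this.continuousAt.tendsto.mono_left nhdsWithin_le_nhds

theorem eventually_meroNorm_mul_le (hR : ∀ i, 0 < R i) (x : Mero a R) (β : Fin d → ℕ) {B : ℝ≥0}
    (h : ENNReal.ofReal (multiPow R β) * boundarySeminorm x < B) :
    ∀ᶠ ρ in 𝓝[{ρ : Fin d → ℝ | ∀ i, 0 < ρ i ∧ ρ i < R i}] R,
      meroNorm ρ x * multiPow ρ β ≤ B := by
  set l := 𝓝[{ρ : Fin d → ℝ | ∀ i, 0 < ρ i ∧ ρ i < R i}] R with hl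
  rcases l.eq_or_neBot with hbot | hbot
  · simp [hbot]
  have hlim : limsup (fun ρ => ENNReal.ofReal (multiPow ρ β)) l =
      ENNReal.ofReal (multiPow R β) :=
    (ENNReal.tendsto_ofReal (tendsto_multiPow β _)).limsup_eq
  have hle : limsup ((fun ρ => ENNReal.ofReal (multiPow ρ β)) *
      fun ρ => ENNReal.ofReal (meroNorm ρ x)) l ≤
      ENNReal.ofReal (multiPow R β) * boundarySeminorm x := by
    refine (ENNReal.limsup_mul_le' (Or.inl ?_) (Or.inl ?_)).trans_eq (by rw [hlim]; rfl)
    · rw [hlim]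
      simpa using multiPow_pos hR β
    · rw [hlim]
      exact ENNReal.ofReal_ne_top
  filter_upwards [eventually_lt_of_limsup_lt (hle.trans_lt h)] with ρ hρ
  rw [Pi.mul_apply, mul_comm, ← ENNReal.ofReal_mul (meroNorm_nonneg x)] at hρ
  simpa using (ENNReal.ofReal_le_iff_le_toReal ENNReal.coe_ne_top).1 hρ.le

theorem boundarySeminorm_le (hR : ∀ i, 0 < R i) (x : Mero a R) (α : Fin d → ℕ) {B : ℝ}
    (h : ∀ᶠ ρ in 𝓝[{ρ : Fin d → ℝ | ∀ i, 0 < ρ i ∧ ρ i < R i}] R,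
      meroNorm ρ x * multiPow ρ α ≤ B) :
    boundarySeminorm x ≤ ENNReal.ofReal (B * (multiPow R α)⁻¹) := by
  unfold boundarySeminorm
  set l := 𝓝[{ρ : Fin d → ℝ | ∀ i, 0 < ρ i ∧ ρ i < R i}] R with hl
  rcases l.eq_or_neBot with hbot | hbot
  · simp [hbot]
  have hlim := ENNReal.tendsto_ofReal
    (((tendsto_multiPow (R := R) α {ρ : Fin d → ℝ | ∀ i, 0 < ρ i ∧ ρ i < R i}).inv₀
      (multiPow_pos hR α).ne').const_mul B)
  rw [← hlim.limsup_eq]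
  refine limsup_le_limsup ?_
  filter_upwards [h, self_mem_nhdsWithin] with ρ h1 hρ
  refine ENNReal.ofReal_le_ofReal ?_
  rw [← div_eq_mul_inv, le_div_iff₀ (multiPow_pos (fun i => (hρ i).1) α)]
  exact h1

end Boundary

end DworkRobba

theorem mainTheorem2 {p : ℕ} [Fact p.Prime] {k : Type*} [NormedField k] [IsUltrametricDist k]
    [CompleteSpace k] [NormedAlgebra ℚ_[p] k] {d μ : ℕ} (hμ : 1 ≤ μ)
    (a : Fin d → k) (r R : Fin d → ℝ) (hR : ∀ i, 0 < R i) (hRr : ∀ i, R i ≤ r i)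
    (G : Fin d → Matrix (Fin μ) (Fin μ) (Mero a r)) (hG : IsIntegrable G)
    (Y : GL (Fin μ) (Mero a R))
    (hY : ∀ i, matPderiv i Y.1 = (G i).map (Mero.restrict a hRr) * Y.1)
    (α : Fin d → ℕ) :
    boundarySeminormMat ((iterGDiv G α).map (Mero.restrict a hRr)) ≤
      (⨆ (β : Fin d → ℕ) (_ : ∑ i, β i < μ), ENNReal.ofReal (∏ i, R i ^ β i) *
          boundarySeminormMat ((((∏ i, (β i).factorial : ℕ) : Mero a r) • iterGDiv G β).map
            (Mero.restrict a hRr))) *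
        (chainConst p (∑ i, α i) (μ - 1) : ENNReal) *
        ENNReal.ofReal (∏ i, R i ^ α i)⁻¹ := by
  have : CharZero k := charZero_of_injective_algebraMap (algebraMap ℚ_[p] k).injective
  obtain ⟨α, rfl⟩ : ∃ α' : Fin d →₀ ℕ, (α' : Fin d → ℕ) = α :=
    ⟨Finsupp.equivFunOnFinite.symm α, rfl⟩
  set C := ⨆ (β : Fin d → ℕ) (_ : ∑ i, β i < μ), ENNReal.ofReal (∏ i, R i ^ β i) *
    boundarySeminormMat ((((∏ i, (β i).factorial : ℕ) : Mero a r) • iterGDiv G β).map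
      (Mero.restrict a hRr)) with hC
  set c := chainConst p (∑ i, α i) (μ - 1) with hc
  have hw : 0 < multiPow R α := multiPow_pos hR α
  have hfact : ∀ β : Fin d → ℕ,
      ((∏ i, (β i).factorial : ℕ) : Mero a r) • iterGDiv G β = iterG G β := by
    intro β
    have : ((∏ i, (β i).factorial : ℕ) : Mero a r) ≠ 0 :=
      Nat.cast_ne_zero.2 (multiFactorial_ne_zero β)
    rw [iterGDiv, smul_smul, mul_inv_cancel₀ this, one_smul]
  -- The estimate holds with any constant larger than `C`, since such a constant bounds the
  -- finitely many derivatives of order less than `μ` at all `ρ` near `R`.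
  have key : ∀ C' : ℝ≥0, C < C' → ∀ u w,
      boundarySeminorm ((iterGDiv G α).map (Mero.restrict a hRr) u w) ≤
        ENNReal.ofReal (C' * c * (multiPow R α)⁻¹) := by
    intro C' hC' u w
    have hfin : {β : Fin d →₀ ℕ | β.degree < μ}.Finite := by
      refine (Set.Finite.preimage (f := fun β : Fin d →₀ ℕ => (β : Fin d → ℕ))
        (DFunLike.coe_injective.injOn) (Set.finite_Iic (fun _ : Fin d => μ))).subset ?_
      intro β hβ i
      exact (Finsupp.le_degree i β).trans (le_of_lt hβ)
    have hev := (hfin.eventually_all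
      (l := 𝓝[{ρ : Fin d → ℝ | ∀ i, 0 < ρ i ∧ ρ i < R i}] R)).2 fun β hβ => by
        refine eventually_meroNorm_mul_le hR (Mero.restrict a hRr (iterG G β u w)) β
          (lt_of_le_of_lt ?_ hC')
        have hβ' : ∑ i, β i < μ := by
          rw [← Finsupp.degree_eq_sum]
          exact hβ
        refine le_trans ?_ (le_iSup₂_of_le (β : Fin d → ℕ) hβ' le_rfl)
        rw [hfact]
        refine mul_le_mul_right (le_iSup_of_le u ?_) _
        exact le_iSup (fun j => boundarySeminorm ((iterG G β).map (Mero.restrict a hRr) u j)) w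
    refine boundarySeminorm_le hR _ α ?_
    filter_upwards [hev, self_mem_nhdsWithin] with ρ h1 hρ
    rw [hc, ← Finsupp.degree_eq_sum]
    exact meroNorm_iterG_le hRr hG Y hY hρ C'.2 u w h1 α
  refine iSup₂_le fun u w => ?_
  -- Otherwise some `C' > C` still violates the estimate.
  by_contra! hlt
  have hK0 : (c : ℝ≥0∞) * ENNReal.ofReal (multiPow R α)⁻¹ ≠ 0 := by
    refine mul_ne_zero ?_ (by simpa using hw)
    exact ENNReal.coe_ne_zero.2 (zero_lt_one.trans_le (one_le_chainConst _ _)).ne'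
  have hK1 : (c : ℝ≥0∞) * ENNReal.ofReal (multiPow R α)⁻¹ ≠ ∞ :=
    ENNReal.mul_ne_top ENNReal.coe_ne_top ENNReal.ofReal_ne_top
  rw [mul_assoc] at hlt
  obtain ⟨C', h1, h2⟩ := ENNReal.lt_iff_exists_nnreal_btwn.1
    ((ENNReal.lt_div_iff_mul_lt (Or.inl hK0) (Or.inl hK1)).2 hlt)
  rw [ENNReal.lt_div_iff_mul_lt (Or.inl hK0) (Or.inl hK1), ← mul_assoc] at h2
  refine (h2.trans_le (key C' h1 u w)).ne ?_
  rw [ENNReal.ofReal_mul (by positivity), ENNReal.ofReal_mul (by positivity),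
    ENNReal.ofReal_coe_nnreal, ENNReal.ofReal_coe_nnreal]
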